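/- For a multi-index $(s_1,\dots,s_r)$ of positive integers with $s_1>1$, let $$\zeta^\star(s_1,\dots,s_r)=\sum_{k_1\ge k_2\ge\cdots\ge k_r\ge 1}\frac{1}{k_1^{s_1}\cdots k_r^{s_r}}$$ (the sum being over positive integers) denote the multiple zeta star value, with $\zeta^\star(\emptyset)=1$, and let $\{3,1\}^d$ denote the sequence $3,1$ repeated $d$ times. Then for every $z\in\mathbb{C}$ with $|z|<1$, $$\sum_{d=0}^{\infty}\zeta^\star(\{3,1\}^d)\,z^{4d}-\sum_{d=0}^{\infty}\zeta^\star(\{3,1\}^d,2)\,z^{4d+2}=\tanh(\pi z/2)\cdot\cot(\pi z/2),$$ where all the series involved (those defining the multiple zeta star values and the two power series) converge absolutely, and the right-hand side at $z=0$, where it has a removable singularity, is understood as its limit $1$. -/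

import Mathlib

/-- The index set of the series for `ζ⋆(s₁, …, s_r)`:
sequences of positive integers `k₁ ≥ k₂ ≥ ⋯ ≥ k_r ≥ 1`. -/
abbrev StarIndex (r : ℕ) : Type := {k : Fin r → ℕ+ // Antitone k}

/-- The summand `1 / (k₁ ^ s₁ ⋯ k_r ^ s_r)`. -/
noncomputable def zetaStarTerm (s : List ℕ) (k : StarIndex s.length) : ℝ :=
  1 / ∏ i : Fin s.length, ((k.1 i : ℕ) : ℝ) ^ s.get i

/-- The multiple zeta star value `ζ⋆(s₁, …, s_r)`; for the empty multi-index it is `1`. -/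
noncomputable def zetaStar (s : List ℕ) : ℝ := ∑' k : StarIndex s.length, zetaStarTerm s k

/-- The multi-index `{3, 1}^d`, i.e. `3, 1, 3, 1, …, 3, 1` with `d` repetitions. -/
def index31 (d : ℕ) : List ℕ := (List.replicate d [3, 1]).flatten

/-- The function `z ↦ tanh (π z / 2) · cot (π z / 2)` on `z ≠ 0`; its singularity at `0` is
removable, and its value there is the limit `1`. -/
noncomputable def tanhCot : ℂ → ℂ :=
  Function.update
    (fun z : ℂ => Complex.tanh (Real.pi * z / 2) * Complex.cot (Real.pi * z / 2)) 0 1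

/-! Write `S_n` for the star sum truncated at `k₁ ≤ n`. Prepending `3, 1` preserves the bound
`2n/(n+1)`, so all the sums converge and are bounded by `2` uniformly in `d`.

Let `C_n = ∑ S_n({3,1}^d) z^{4d} - z² ∑ S_n({3,1}^d,2) z^{4d}`, and let `D_n` be the same with an
extra leading `1`. Peeling off the largest summation index gives `C_{n+1} = C_n - z²/(n+1)² + z⁴
D_{n+1}/(n+1)³` and `D_{n+1} = D_n + C_{n+1}/(n+1)`. With `P_k` the alternating product `altProd`
and `w_n(k) = n!²/((n-k)!(n+k)!)`, this system is solved by `C_n = 1 + ∑ w_n(k)(P_k - P_{k-1})`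
(`genFun_sub_eq_weightedSum`); the key input is the telescoping identity
`sum_centralWeight_mul_altProd_sub`.

As `n → ∞` the weights tend to `1`, so the sum telescopes to `lim P_k`, which Euler's sine product
evaluates as `tanh(πz/2) cot(πz/2)`. -/

open Filter Topology Finset

/-! ### Truncated star sums and their relation to the star series -/

/-- The truncation of `ζ⋆(s₁, …, s_r)` to sequences `n ≥ k₁ ≥ ⋯ ≥ k_r ≥ 1`. -/
noncomputable def starSum : List ℕ → ℕ → ℝ
  | [], _ => 1
  | a :: s, n => ∑ k ∈ range n, starSum s (k + 1) / ((k : ℝ) + 1) ^ a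

theorem starSum_nil (n : ℕ) : starSum [] n = 1 := rfl

theorem starSum_cons (a : ℕ) (s : List ℕ) (n : ℕ) :
    starSum (a :: s) n = ∑ k ∈ range n, starSum s (k + 1) / ((k : ℝ) + 1) ^ a := rfl

theorem starSum_cons_succ (a : ℕ) (s : List ℕ) (n : ℕ) :
    starSum (a :: s) (n + 1) = starSum (a :: s) n + starSum s (n + 1) / ((n : ℝ) + 1) ^ a :=
  sum_range_succ _ _

theorem starSum_nonneg (s : List ℕ) (n : ℕ) : 0 ≤ starSum s n := by
  induction s generalizing n with
  | nil => exact zero_le_one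
  | cons a s ih => exact sum_nonneg fun k _ => div_nonneg (ih _) (by positivity)

theorem Fin.antitone_cons_iff {r : ℕ} (a : ℕ+) (k : Fin r → ℕ+) :
    Antitone (Fin.cons a k : Fin (r + 1) → ℕ+) ↔ Antitone k ∧ ∀ i, k i ≤ a := by
  constructor
  · intro h
    refine ⟨fun i j hij => ?_, fun i => ?_⟩
    · simpa using h (Fin.succ_le_succ_iff.2 hij)
    · simpa using h (Fin.zero_le i.succ)
  · rintro ⟨h₁, h₂⟩ i j
    refine Fin.cases ?_ (fun i => ?_) i <;> refine Fin.cases ?_ (fun j => ?_) j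
    · simp
    · simpa using h₂ j
    · intro h; exact absurd h (by simp)
    · intro h; simpa using h₁ (Fin.succ_le_succ_iff.1 h)

/-- Once the leading entry `a` is fixed, the tail must be antitone and bounded by `a`. Values in
`ENNReal` allow the reordering without summability. The predicate `p` serves both the truncated sums
(`a ≤ n`) and the full series (`True`). -/
theorem tsum_antitone_cons {r : ℕ} (p : ℕ+ → Prop) [DecidablePred p] (f : ℕ+ → ENNReal)
    (g : (Fin r → ℕ+) → ENNReal) (F : (Fin (r + 1) → ℕ+) → ENNReal)
    (hF : ∀ a k, F (Fin.cons a k) = f a * g k) :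
    ∑' k : Fin (r + 1) → ℕ+, (if Antitone k ∧ p (k 0) then F k else 0) =
      ∑' a : ℕ+, if p a then
        f a * ∑' k : Fin r → ℕ+, (if Antitone k ∧ ∀ i, k i ≤ a then g k else 0) else 0 := by
  rw [← (Fin.consEquiv fun _ : Fin (r + 1) => ℕ+).tsum_eq, ENNReal.tsum_prod']
  refine tsum_congr fun a => ?_
  split_ifs with hp
  · rw [← ENNReal.tsum_mul_left]
    refine tsum_congr fun k => ?_
    simp [Fin.consEquiv, Fin.antitone_cons_iff, hF, hp]
  · simp [Fin.consEquiv, hp]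

/-- The summand of a multiple zeta star series, at an arbitrary sequence of positive integers. -/
noncomputable def indexTerm (s : List ℕ) (k : Fin s.length → ℕ+) : ENNReal :=
  ENNReal.ofReal (1 / ∏ i : Fin s.length, ((k i : ℕ) : ℝ) ^ s.get i)

theorem indexTerm_cons (a : ℕ) (s : List ℕ) (m : ℕ+) (k : Fin s.length → ℕ+) :
    indexTerm (a :: s) (Fin.cons m k : Fin (s.length + 1) → ℕ+) =
      ENNReal.ofReal (1 / (m : ℝ) ^ a) * indexTerm s k := by
  unfold indexTerm
  rw [← ENNReal.ofReal_mul (by positivity), one_div_mul_one_div]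
  congr 2
  exact Fin.prod_univ_succ (n := s.length)
    fun i => (((Fin.cons m k : Fin (s.length + 1) → ℕ+) i : ℕ) : ℝ) ^ (a :: s).get i

theorem tsum_antitone_le_eq_starSum (s : List ℕ) (n : ℕ+) :
    ∑' k : Fin s.length → ℕ+, (if Antitone k ∧ ∀ i, k i ≤ n then indexTerm s k else 0) =
      ENNReal.ofReal (starSum s n) := by
  induction s generalizing n with
  | nil =>
    rw [tsum_eq_single (fun i => i.elim0 : Fin ([] : List ℕ).length → ℕ+)
      (fun k hk => absurd (funext fun i => i.elim0) hk), if_pos ⟨fun i => i.elim0, fun i => i.elim0⟩]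
    simp [starSum_nil, indexTerm]
  | cons a s ih =>
    have hcond (k : Fin (s.length + 1) → ℕ+) :
        (Antitone k ∧ ∀ i, k i ≤ n) ↔ (Antitone k ∧ k 0 ≤ n) :=
      ⟨fun h => ⟨h.1, h.2 0⟩, fun h => ⟨h.1, fun i => (h.1 (Fin.zero_le i)).trans h.2⟩⟩
    have h := tsum_antitone_cons (r := s.length) (fun m => m ≤ n) _ _ (indexTerm (a :: s))
      (indexTerm_cons a s)
    simp only [ih] at h
    refine Eq.trans (tsum_congr fun k => ?_) (h.trans ?_)
    · exact if_congr (hcond k) rfl rfl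
    · simp only [← PNat.coe_le_coe]
      rw [tsum_pnat_eq_tsum_succ (f := fun m : ℕ => if m ≤ (n : ℕ) then
        ENNReal.ofReal (1 / (m : ℝ) ^ a) * ENNReal.ofReal (starSum s m) else 0),
        tsum_eq_sum (s := range n), starSum_cons,
        ENNReal.ofReal_sum_of_nonneg fun k _ => div_nonneg (starSum_nonneg _ _) (by positivity)]
      · refine sum_congr rfl fun k hk => ?_
        rw [if_pos (by simpa using hk), ← ENNReal.ofReal_mul (by positivity)]
        push_cast
        congr 1; ring
      · intro k hk
        rw [if_neg (by simpa using hk)]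

theorem tsum_ofReal_zetaStarTerm_cons (a : ℕ) (s : List ℕ) :
    ∑' k : StarIndex (a :: s).length, ENNReal.ofReal (zetaStarTerm (a :: s) k) =
      ∑' k : ℕ, ENNReal.ofReal (starSum s (k + 1) / ((k : ℝ) + 1) ^ a) := by
  have h := tsum_antitone_cons (r := s.length) (fun _ => True) _ _ (indexTerm (a :: s))
    (indexTerm_cons a s)
  simp only [and_true, if_true, tsum_antitone_le_eq_starSum] at h
  have h₁ := tsum_subtype {k : Fin (s.length + 1) → ℕ+ | Antitone k} (indexTerm (a :: s))
  refine h₁.trans (Eq.trans (tsum_congr fun k => ?_) (h.trans ?_))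
  · simp [Set.indicator_apply]
  · rw [tsum_pnat_eq_tsum_succ (f := fun m : ℕ =>
        ENNReal.ofReal (1 / (m : ℝ) ^ a) * ENNReal.ofReal (starSum s m))]
    refine tsum_congr fun k => ?_
    rw [← ENNReal.ofReal_mul (by positivity)]
    push_cast
    congr 1; ring

theorem zetaStarTerm_nonneg (s : List ℕ) (k : StarIndex s.length) : 0 ≤ zetaStarTerm s k := by
  unfold zetaStarTerm; positivity

theorem hasSum_zetaStarTerm_nil : HasSum (zetaStarTerm []) 1 := by
  have h := hasSum_single (f := zetaStarTerm []) (⟨fun i => i.elim0, fun i => i.elim0⟩)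
    (fun k hk => absurd (Subtype.ext (funext fun i => i.elim0)) hk)
  simpa [zetaStarTerm] using h

/-- A multiple zeta star series with bounded truncations converges absolutely, and it is the limit
of its truncations. -/
theorem summable_zetaStarTerm_and_tendsto_starSum {s : List ℕ} {B : ℝ}
    (hB : ∀ n, starSum s n ≤ B) :
    Summable (zetaStarTerm s) ∧ Tendsto (starSum s) atTop (𝓝 (zetaStar s)) := by
  cases s with
  | nil =>
    refine ⟨hasSum_zetaStarTerm_nil.summable, ?_⟩
    rw [zetaStar, hasSum_zetaStarTerm_nil.tsum_eq]
    exact tendsto_const_nhds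
  | cons a s =>
    have hnn (k : ℕ) : 0 ≤ starSum s (k + 1) / ((k : ℝ) + 1) ^ a :=
      div_nonneg (starSum_nonneg _ _) (by positivity)
    have hs : Summable fun k : ℕ => starSum s (k + 1) / ((k : ℝ) + 1) ^ a :=
      summable_of_sum_range_le hnn hB
    have key := tsum_ofReal_zetaStarTerm_cons a s
    have hS : Summable (zetaStarTerm (a :: s)) := by
      refine (ENNReal.summable_toReal (f := fun k => ENNReal.ofReal (zetaStarTerm (a :: s) k))
        ?_).congr fun k => ENNReal.toReal_ofReal (zetaStarTerm_nonneg _ _)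
      rw [key]
      exact hs.tsum_ofReal_ne_top
    refine ⟨hS, ?_⟩
    rw [← ENNReal.ofReal_tsum_of_nonneg (zetaStarTerm_nonneg _) hS,
      ← ENNReal.ofReal_tsum_of_nonneg hnn hs, ENNReal.ofReal_eq_ofReal_iff
        (tsum_nonneg (zetaStarTerm_nonneg _)) (tsum_nonneg hnn)] at key
    rw [zetaStar, key]
    exact hs.hasSum.tendsto_sum_nat

theorem index31_succ (d : ℕ) : index31 (d + 1) = 3 :: 1 :: index31 d := by
  simp [index31, List.replicate_succ]

/-! ### Bounds uniform in the number of blocks -/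

/-- The right side increases by `2/((n+1)(n+2))`, which is at least `1/(n+1)²`. -/
theorem sum_range_one_div_sq_le (n : ℕ) :
    ∑ k ∈ range n, 1 / ((k : ℝ) + 1) ^ 2 ≤ 2 * (n : ℝ) / (n + 1) := by
  induction n with
  | zero => simp
  | succ n ih =>
    rw [sum_range_succ]
    refine (add_le_add_left ih _).trans ?_
    push_cast
    rw [div_add_div _ _ (by positivity) (by positivity),
      div_le_div_iff₀ (by positivity) (by positivity)]
    have : (0 : ℝ) ≤ n := n.cast_nonneg
    have : (0 : ℝ) ≤ (n : ℝ) ^ 2 := by positivity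
    have : (0 : ℝ) ≤ (n : ℝ) ^ 3 := by positivity
    nlinarith

/-- Each summand is at most `2/(k+2) ≤ 1`. The resulting linear growth turns a following division by
`k³` into `1/k²`, which reproduces the original bound. -/
theorem starSum_one_cons_le {s : List ℕ} (hs : ∀ n, starSum s (n + 1) ≤ 2 * (n + 1) / (n + 2))
    (n : ℕ) : starSum (1 :: s) n ≤ n := by
  rw [starSum_cons]
  refine (sum_le_card_nsmul _ _ 1 fun k _ => ?_).trans (by simp)
  rw [div_le_one (by positivity), pow_one]
  refine (hs k).trans ?_
  rw [div_le_iff₀ (by positivity)]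
  have : (0 : ℝ) ≤ k := k.cast_nonneg
  nlinarith

/-- Prepending `3, 1` to the index preserves the bound `2 n / (n + 1)` on the truncations. -/
theorem starSum_index31_append_le {s : List ℕ}
    (hs : ∀ n, starSum s (n + 1) ≤ 2 * (n + 1) / (n + 2)) (d n : ℕ) :
    starSum (index31 d ++ s) (n + 1) ≤ 2 * (n + 1) / (n + 2) := by
  induction d generalizing n with
  | zero => simpa [index31] using hs n
  | succ d ih =>
    rw [index31_succ, List.cons_append, List.cons_append, starSum_cons]
    have := sum_range_one_div_sq_le (n + 1)
    push_cast at this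
    rw [show (n : ℝ) + 1 + 1 = n + 2 by ring] at this
    refine (sum_le_sum fun k _ => ?_).trans this
    have := starSum_one_cons_le ih (k + 1)
    push_cast at this
    rw [div_le_div_iff₀ (by positivity) (by positivity)]
    calc _ ≤ ((k : ℝ) + 1) * (k + 1) ^ 2 := by gcongr
      _ = _ := by ring

theorem starSum_nil_le (n : ℕ) : starSum [] (n + 1) ≤ 2 * (n + 1) / (n + 2) := by
  rw [starSum_nil, le_div_iff₀ (by positivity)]
  have : (0 : ℝ) ≤ n := n.cast_nonneg
  linarith

theorem starSum_two_le (n : ℕ) : starSum [2] (n + 1) ≤ 2 * (n + 1) / (n + 2) := by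
  have := sum_range_one_div_sq_le (n + 1)
  push_cast at this
  rw [show (n : ℝ) + 1 + 1 = n + 2 by ring] at this
  simpa [starSum_cons, starSum_nil] using this

theorem starSum_index31_append_le_two {s : List ℕ} (h₀ : starSum s 0 ≤ 2)
    (hs : ∀ n, starSum s (n + 1) ≤ 2 * (n + 1) / (n + 2)) (d n : ℕ) :
    starSum (index31 d ++ s) n ≤ 2 := by
  -- The bound `2n/(n+1)` would be `0` at `n = 0`, where the empty index gives `1`; hence the
  -- separate case.
  cases n with
  | zero =>
    cases d with
    | zero => simpa [index31] using h₀
    | succ d => simp [index31_succ, starSum_cons]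
  | succ n =>
    refine (starSum_index31_append_le hs d n).trans ?_
    rw [div_le_iff₀ (by positivity)]
    linarith

/-! ### Generating functions of truncated sums and their recurrences -/

/-- The generating function `∑ S_n({3,1}^d, s) z^{4d}` of truncated sums. -/
noncomputable def genFun (s : List ℕ) (z : ℂ) (n : ℕ) : ℂ :=
  ∑' d : ℕ, (starSum (index31 d ++ s) n : ℂ) * z ^ (4 * d)

/-- The generating function `∑ S_n(1, {3,1}^d, s) z^{4d}` of truncated sums. -/
noncomputable def genFunOne (s : List ℕ) (z : ℂ) (n : ℕ) : ℂ :=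
  ∑' d : ℕ, (starSum (1 :: (index31 d ++ s)) n : ℂ) * z ^ (4 * d)

theorem norm_ofReal_mul_pow_le {a B : ℝ} (h₀ : 0 ≤ a) (h : a ≤ B) (z : ℂ) (d : ℕ) :
    ‖(a : ℂ) * z ^ (4 * d)‖ ≤ B * (‖z‖ ^ 4) ^ d := by
  rw [norm_mul, norm_pow, pow_mul, Complex.norm_real, Real.norm_of_nonneg h₀]
  gcongr

theorem summable_const_mul_norm_pow (B : ℝ) {z : ℂ} (hz : ‖z‖ < 1) :
    Summable fun d : ℕ => B * (‖z‖ ^ 4) ^ d :=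
  (summable_geometric_of_lt_one (by positivity)
    (pow_lt_one₀ (norm_nonneg z) hz (by norm_num))).mul_left B

theorem summable_ofReal_mul_pow {a : ℕ → ℝ} {B : ℝ} (h₀ : ∀ d, 0 ≤ a d) (h : ∀ d, a d ≤ B)
    {z : ℂ} (hz : ‖z‖ < 1) : Summable fun d => (a d : ℂ) * z ^ (4 * d) :=
  .of_norm_bounded (summable_const_mul_norm_pow B hz)
    fun d => norm_ofReal_mul_pow_le (h₀ d) (h d) z d

theorem genFun_zero (s : List ℕ) (z : ℂ) : genFun s z 0 = starSum s 0 := by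
  rw [genFun, tsum_eq_single 0]
  · simp [index31]
  · intro d hd
    obtain ⟨d, rfl⟩ := Nat.exists_eq_succ_of_ne_zero hd
    simp [index31_succ, starSum_cons]

theorem genFunOne_zero (s : List ℕ) (z : ℂ) : genFunOne s z 0 = 0 := by
  simp [genFunOne, starSum_cons]

theorem summable_genFun {s : List ℕ} (h₀ : starSum s 0 ≤ 2)
    (hs : ∀ n, starSum s (n + 1) ≤ 2 * (n + 1) / (n + 2)) {z : ℂ} (hz : ‖z‖ < 1) (n : ℕ) :
    Summable fun d : ℕ => (starSum (index31 d ++ s) n : ℂ) * z ^ (4 * d) :=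
  summable_ofReal_mul_pow (fun _ => starSum_nonneg _ _)
    (fun d => starSum_index31_append_le_two h₀ hs d n) hz

theorem summable_genFunOne {s : List ℕ}
    (hs : ∀ n, starSum s (n + 1) ≤ 2 * (n + 1) / (n + 2)) {z : ℂ} (hz : ‖z‖ < 1) (n : ℕ) :
    Summable fun d : ℕ => (starSum (1 :: (index31 d ++ s)) n : ℂ) * z ^ (4 * d) :=
  summable_ofReal_mul_pow (fun _ => starSum_nonneg _ _)
    (fun d => starSum_one_cons_le (starSum_index31_append_le hs d) n) hz

theorem genFunOne_succ {s : List ℕ} (h₀ : starSum s 0 ≤ 2)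
    (hs : ∀ n, starSum s (n + 1) ≤ 2 * (n + 1) / (n + 2)) {z : ℂ} (hz : ‖z‖ < 1) (n : ℕ) :
    genFunOne s z (n + 1) = genFunOne s z n + genFun s z (n + 1) / (n + 1) := by
  unfold genFunOne genFun
  rw [← tsum_div_const, ← (summable_genFunOne hs hz n).tsum_add
    ((summable_genFun h₀ hs hz (n + 1)).div_const _)]
  refine tsum_congr fun d => ?_
  rw [starSum_cons_succ]
  push_cast
  ring

theorem genFun_eq {s : List ℕ} (h₀ : starSum s 0 ≤ 2)
    (hs : ∀ n, starSum s (n + 1) ≤ 2 * (n + 1) / (n + 2)) {z : ℂ} (hz : ‖z‖ < 1) (n : ℕ) :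
    genFun s z n = starSum s n + ∑' d : ℕ, (starSum (index31 (d + 1) ++ s) n : ℂ) *
      z ^ (4 * (d + 1)) := by
  rw [genFun, (summable_genFun h₀ hs hz n).tsum_eq_zero_add]
  simp [index31]

/-- The `d = 0` term is removed because only the others begin with `3, 1`; shifting `d` in those
produces the factor `z⁴`. -/
theorem genFun_succ {s : List ℕ} (h₀ : starSum s 0 ≤ 2)
    (hs : ∀ n, starSum s (n + 1) ≤ 2 * (n + 1) / (n + 2)) {z : ℂ} (hz : ‖z‖ < 1) (n : ℕ) :
    genFun s z (n + 1) - starSum s (n + 1) = genFun s z n - starSum s n +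
      z ^ 4 * genFunOne s z (n + 1) / (n + 1) ^ 3 := by
  rw [genFun_eq h₀ hs hz, genFun_eq h₀ hs hz, add_sub_cancel_left, add_sub_cancel_left, genFunOne,
    ← tsum_mul_left, ← tsum_div_const,
    ← ((summable_nat_add_iff 1).2 (summable_genFun h₀ hs hz n)).tsum_add
      (((summable_genFunOne hs hz (n + 1)).mul_left _).div_const _)]
  refine tsum_congr fun d => ?_
  rw [index31_succ, List.cons_append, List.cons_append, starSum_cons_succ]
  push_cast
  ring

theorem zetaStar_index31_append {s : List ℕ} (h₀ : starSum s 0 ≤ 2)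
    (hs : ∀ n, starSum s (n + 1) ≤ 2 * (n + 1) / (n + 2)) (d : ℕ) :
    Summable (zetaStarTerm (index31 d ++ s)) ∧
      Tendsto (starSum (index31 d ++ s)) atTop (𝓝 (zetaStar (index31 d ++ s))) :=
  summable_zetaStarTerm_and_tendsto_starSum (starSum_index31_append_le_two h₀ hs d)

theorem summable_zetaStar_mul_pow {s : List ℕ} (h₀ : starSum s 0 ≤ 2)
    (hs : ∀ n, starSum s (n + 1) ≤ 2 * (n + 1) / (n + 2)) {z : ℂ} (hz : ‖z‖ < 1) :
    Summable fun d : ℕ => (zetaStar (index31 d ++ s) : ℂ) * z ^ (4 * d) :=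
  summable_ofReal_mul_pow (B := 2) (fun _ => tsum_nonneg (zetaStarTerm_nonneg _))
    (fun d => le_of_tendsto' (zetaStar_index31_append h₀ hs d).2
      (starSum_index31_append_le_two h₀ hs d)) hz

theorem tendsto_genFun {s : List ℕ} (h₀ : starSum s 0 ≤ 2)
    (hs : ∀ n, starSum s (n + 1) ≤ 2 * (n + 1) / (n + 2)) {z : ℂ} (hz : ‖z‖ < 1) :
    Tendsto (genFun s z) atTop
      (𝓝 (∑' d : ℕ, (zetaStar (index31 d ++ s) : ℂ) * z ^ (4 * d))) := by
  refine tendsto_tsum_of_dominated_convergence (summable_const_mul_norm_pow 2 hz) (fun d => ?_)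
    (Eventually.of_forall fun n d => norm_ofReal_mul_pow_le (starSum_nonneg _ _)
      (starSum_index31_append_le_two h₀ hs d n) z d)
  exact (Complex.continuous_ofReal.tendsto _ |>.comp
    (zetaStar_index31_append h₀ hs d).2).mul_const _

/-! ### Central weights, the alternating product and the closed form -/

/-- The weight `n!² / ((n - k)! (n + k)!)`, which vanishes for `k > n`. -/
noncomputable def centralWeight (n k : ℕ) : ℝ :=
  ∏ j ∈ range k, ((n : ℝ) - j) / (n + j + 1)

theorem centralWeight_zero_right (n : ℕ) : centralWeight n 0 = 1 := prod_range_zero _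

theorem centralWeight_succ_right (n k : ℕ) :
    centralWeight n (k + 1) * (n + k + 1) = centralWeight n k * (n - k) := by
  have : (n : ℝ) + k + 1 ≠ 0 := by positivity
  rw [centralWeight, prod_range_succ, ← centralWeight]
  field_simp

/-- The cross-multiplied form stays valid at `k = n + 1`, where both sides vanish. -/
theorem centralWeight_succ_left (n k : ℕ) :
    centralWeight (n + 1) k * (((n : ℝ) + 1) ^ 2 - (k : ℝ) ^ 2) =
      centralWeight n k * ((n : ℝ) + 1) ^ 2 := by
  induction k with
  | zero => simp [centralWeight_zero_right]
  | succ k ih =>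
    have h₁ := centralWeight_succ_right n k
    have h₂ := centralWeight_succ_right (n + 1) k
    push_cast at h₂ ⊢
    have h : (n : ℝ) + k + 1 ≠ 0 := by positivity
    apply mul_left_cancel₀ h
    linear_combination ((n : ℝ) + k + 1) * (n - k) * h₂ - ((n : ℝ) + 1) ^ 2 * h₁ + (n - k) * ih

theorem centralWeight_eq_zero {n k : ℕ} (h : n < k) : centralWeight n k = 0 :=
  prod_eq_zero (mem_range.2 h) (by simp)

theorem abs_centralWeight_le_one (n k : ℕ) : |centralWeight n k| ≤ 1 := by
  rcases lt_or_ge n k with h | h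
  · simp [centralWeight_eq_zero h]
  · rw [centralWeight, abs_prod]
    refine prod_le_one (fun _ _ => abs_nonneg _) fun j hj => ?_
    have hj : (j : ℝ) ≤ n := by exact_mod_cast ((mem_range.1 hj).le.trans h)
    have : (0 : ℝ) ≤ j := j.cast_nonneg
    rw [abs_of_nonneg (div_nonneg (by linarith) (by positivity)), div_le_one (by positivity)]
    linarith

theorem tendsto_centralWeight (k : ℕ) : Tendsto (fun n => centralWeight n k) atTop (𝓝 1) := by
  have h (j : ℕ) : Tendsto (fun n : ℕ => ((n : ℝ) - j) / (n + j + 1)) atTop (𝓝 1) := by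
    have h₁ : Tendsto (fun n : ℕ => 1 - (2 * (j : ℝ) + 1) / (n + (j + 1))) atTop (𝓝 (1 - 0)) :=
      tendsto_const_nhds.sub (tendsto_const_nhds.div_atTop
        (tendsto_atTop_add_const_right _ _ tendsto_natCast_atTop_atTop))
    rw [sub_zero] at h₁
    refine h₁.congr fun n => ?_
    have : (n : ℝ) + j + 1 ≠ 0 := by positivity
    rw [← add_assoc]
    field_simp
    ring
  simpa only [centralWeight, prod_const_one] using tendsto_finsetProd (range k) fun j _ => h j

/-- The partial product `∏_{k ≤ n} (1 + (-1)^k z² / k²) / (1 - (-1)^k z² / k²)`. -/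
noncomputable def altProd (z : ℂ) (n : ℕ) : ℂ :=
  ∏ k ∈ range n, (((k : ℂ) + 1) ^ 2 - (-1) ^ k * z ^ 2) / (((k : ℂ) + 1) ^ 2 + (-1) ^ k * z ^ 2)

theorem altProd_zero (z : ℂ) : altProd z 0 = 1 := prod_range_zero _

theorem natCast_succ_sq_add_ne_zero {u : ℂ} (hu : ‖u‖ < 1) (k : ℕ) : ((k : ℂ) + 1) ^ 2 + u ≠ 0 := by
  intro h
  have h₁ : ‖u‖ = ((k : ℝ) + 1) ^ 2 := by
    rw [eq_neg_of_add_eq_zero_right h, norm_neg, norm_pow]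
    congr 1
    exact_mod_cast Complex.norm_natCast (k + 1)
  have : (0 : ℝ) ≤ k := k.cast_nonneg
  nlinarith

theorem norm_neg_one_pow_mul_sq_lt {z : ℂ} (hz : ‖z‖ < 1) (k : ℕ) : ‖(-1) ^ k * z ^ 2‖ < 1 := by
  simpa using pow_lt_one₀ (norm_nonneg z) hz two_ne_zero

theorem altProd_succ {z : ℂ} (hz : ‖z‖ < 1) (k : ℕ) :
    altProd z (k + 1) * (((k : ℂ) + 1) ^ 2 + (-1) ^ k * z ^ 2) =
      altProd z k * (((k : ℂ) + 1) ^ 2 - (-1) ^ k * z ^ 2) := by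
  rw [altProd, prod_range_succ, ← altProd, mul_assoc,
    div_mul_cancel₀ _ (natCast_succ_sq_add_ne_zero (norm_neg_one_pow_mul_sq_lt hz k) k)]

/-- The sum `1 + ∑_{k ≤ n} w_n(k) (P_k - P_{k-1})`. -/
noncomputable def weightedSum (z : ℂ) (n : ℕ) : ℂ :=
  1 + ∑ k ∈ range n, (centralWeight n (k + 1) : ℂ) * (altProd z (k + 1) - altProd z k)

/-- The sum `∑_{k ≤ n} w_n(k) k² (P_k - P_{k-1})`. -/
noncomputable def weightedSumSq (z : ℂ) (n : ℕ) : ℂ :=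
  ∑ k ∈ range n, (centralWeight n (k + 1) : ℂ) * ((k : ℂ) + 1) ^ 2 *
    (altProd z (k + 1) - altProd z k)

theorem centralWeight_succ_left_cast (n k : ℕ) :
    (centralWeight (n + 1) (k + 1) : ℂ) * (((n : ℂ) + 1) ^ 2 - ((k : ℂ) + 1) ^ 2) =
      centralWeight n (k + 1) * ((n : ℂ) + 1) ^ 2 := by
  exact_mod_cast centralWeight_succ_left n (k + 1)

theorem centralWeight_succ_right_cast (n k : ℕ) :
    (centralWeight n (k + 1) : ℂ) * ((n : ℂ) + k + 1) = centralWeight n k * ((n : ℂ) - k) := by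
  exact_mod_cast centralWeight_succ_right n k

theorem weightedSum_succ (z : ℂ) (n : ℕ) :
    weightedSum z (n + 1) = weightedSum z n + weightedSumSq z (n + 1) / ((n : ℂ) + 1) ^ 2 := by
  have hn : (n : ℂ) + 1 ≠ 0 := n.cast_add_one_ne_zero
  -- The additional term has weight `w_n(n+1) = 0`, so both sums run over the same range.
  have h : weightedSum z n = 1 + ∑ k ∈ range (n + 1),
      (centralWeight n (k + 1) : ℂ) * (altProd z (k + 1) - altProd z k) := by
    rw [weightedSum, sum_range_succ, centralWeight_eq_zero n.lt_succ_self]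
    simp
  rw [h, weightedSum, weightedSumSq, add_assoc, sum_div, ← sum_add_distrib]
  congr 1
  refine sum_congr rfl fun k _ => ?_
  field_simp
  linear_combination (altProd z (k + 1) - altProd z k) * centralWeight_succ_left_cast n k

/-- A telescoping identity for the weights and the partial products. -/
theorem sum_centralWeight_mul_altProd_sub {z : ℂ} (hz : ‖z‖ < 1) (n : ℕ) :
    ∑ k ∈ range (n + 1), (centralWeight (n + 1) (k + 1) : ℂ) *
        (((k : ℂ) + 1) ^ 2 * (((n : ℂ) + 1) ^ 2 + n * ((k : ℂ) + 1) ^ 2) - z ^ 4 * (n + 1)) *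
        (altProd z (k + 1) - altProd z k) =
      ((n : ℂ) + 1) * (z ^ 4 - z ^ 2 * (n + 1)) := by
  -- The antidifference of the summand. Its factor `n + 1 - k` vanishes at the upper end, so only
  -- minus its value at `k = 0` survives.
  have h := sum_range_sub (fun k : ℕ => ((n : ℂ) + 1 - k) * centralWeight (n + 1) k * altProd z k *
    (-z ^ 4 + (-1) ^ k * z ^ 2 * (n + 1 + k + k ^ 2))) (n + 1)
  simp only [centralWeight_zero_right, altProd_zero] at h
  refine Eq.trans (sum_congr rfl fun k _ => ?_) (h.trans ?_)
  · have h₁ := centralWeight_succ_right_cast (n + 1) k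
    have h₂ := altProd_succ hz k
    have h₃ : ((-1 : ℂ) ^ k) ^ 2 = 1 := by rw [← pow_mul, mul_comm, pow_mul]; simp
    push_cast at h₁ ⊢
    rw [pow_succ (-1 : ℂ) k]
    linear_combination
      -(centralWeight (n + 1) (k + 1) : ℂ) * (((k : ℂ) + 1) * ((-1) ^ k * z ^ 2) -
        (((n : ℂ) + 1) ^ 2 + n * ((k : ℂ) + 1) ^ 2)) * h₂ -
      altProd z k * (-z ^ 4 + (-1) ^ k * z ^ 2 * (n + 1 + k + k ^ 2)) * h₁ +
      (centralWeight (n + 1) (k + 1) : ℂ) * ((k : ℂ) + 1) * z ^ 4 *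
        (altProd z (k + 1) + altProd z k) * h₃
  · push_cast; ring

/-- This is the recurrence of `D_n` under the substitution `z⁴ D_n = n (z² + weightedSumSq z n)`.
Rewriting `w_n` through `w_{n+1}` reduces it to the telescoping identity. -/
theorem weightedSumSq_succ {z : ℂ} (hz : ‖z‖ < 1) (n : ℕ) :
    ((n : ℂ) + 1) * (z ^ 2 + weightedSumSq z (n + 1)) =
      n * (z ^ 2 + weightedSumSq z n) + z ^ 4 * weightedSum z (n + 1) / (n + 1) := by
  have hn : (n : ℂ) + 1 ≠ 0 := n.cast_add_one_ne_zero
  have h : weightedSumSq z n = ∑ k ∈ range (n + 1),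
      (centralWeight n (k + 1) : ℂ) * ((k : ℂ) + 1) ^ 2 *
        (altProd z (k + 1) - altProd z k) := by
    rw [weightedSumSq, sum_range_succ, centralWeight_eq_zero n.lt_succ_self]
    simp
  have h₁ := sum_centralWeight_mul_altProd_sub hz n
  have h₂ : ∑ k ∈ range (n + 1), (centralWeight (n + 1) (k + 1) : ℂ) *
        (((k : ℂ) + 1) ^ 2 * (((n : ℂ) + 1) ^ 2 + n * ((k : ℂ) + 1) ^ 2) - z ^ 4 * (n + 1)) *
        (altProd z (k + 1) - altProd z k) =
      (n + 1) ^ 3 * weightedSumSq z (n + 1) - n * (n + 1) ^ 2 * weightedSumSq z n -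
        z ^ 4 * (n + 1) * (weightedSum z (n + 1) - 1) := by
    rw [h, weightedSumSq, weightedSum, add_sub_cancel_left, mul_sum, mul_sum, mul_sum,
      ← sum_sub_distrib, ← sum_sub_distrib]
    refine sum_congr rfl fun k _ => ?_
    linear_combination (-n * ((k : ℂ) + 1) ^ 2 * (altProd z (k + 1) - altProd z k)) *
      centralWeight_succ_left_cast n k
  rw [h₁] at h₂
  field_simp
  apply mul_left_cancel₀ hn
  linear_combination -h₂

theorem starSum_two_succ (n : ℕ) : starSum [2] (n + 1) = starSum [2] n + 1 / ((n : ℝ) + 1) ^ 2 := by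
  rw [starSum_cons_succ, starSum_nil]

/-- Closed form of the generating function of the truncated sums. -/
theorem genFun_sub_eq_weightedSum {z : ℂ} (hz : ‖z‖ < 1) (n : ℕ) :
    genFun [] z n - z ^ 2 * genFun [2] z n = weightedSum z n ∧
      z ^ 4 * (genFunOne [] z n - z ^ 2 * genFunOne [2] z n) =
        n * (z ^ 2 + weightedSumSq z n) := by
  have h₀ : starSum [] 0 ≤ 2 := by norm_num [starSum_nil]
  have h₀' : starSum [2] 0 ≤ 2 := by norm_num [starSum_cons]
  induction n with
  | zero => simp [genFun_zero, genFunOne_zero, starSum_nil, starSum_cons, weightedSum]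
  | succ n ih =>
    obtain ⟨ih₁, ih₂⟩ := ih
    have hn : (n : ℂ) + 1 ≠ 0 := n.cast_add_one_ne_zero
    have hA := genFun_succ h₀ starSum_nil_le hz n
    have hB := genFun_succ h₀' starSum_two_le hz n
    have hA' := genFunOne_succ h₀ starSum_nil_le hz n
    have hB' := genFunOne_succ h₀' starSum_two_le hz n
    have hX := weightedSum_succ z n
    have hE := weightedSumSq_succ hz n
    rw [starSum_two_succ] at hB
    rw [starSum_nil, starSum_nil] at hA
    push_cast at hB ⊢
    set X := weightedSum z (n + 1)
    set T := weightedSumSq z (n + 1)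
    set C := genFun [] z (n + 1) - z ^ 2 * genFun [2] z (n + 1) with hC
    set D := genFunOne [] z (n + 1) - z ^ 2 * genFunOne [2] z (n + 1) with hD
    -- The recurrences are implicit: `C` and `D` at `n + 1` involve each other. Eliminating `D`
    -- leaves `((n+1)⁴ - z⁴)(C - X) = 0`, and the first factor is nonzero since `‖z‖ < 1`.
    have h₁ : C - X = (z ^ 4 * D - (n + 1) * (z ^ 2 + T)) / (n + 1) ^ 3 := by
      have e : ((n : ℂ) + 1) * (z ^ 2 + T) / (n + 1) ^ 3 = (z ^ 2 + T) / (n + 1) ^ 2 := by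
        field_simp
      rw [sub_div, e, hC, hD, hX]
      linear_combination hA - z ^ 2 * hB + ih₁
    have h₂ : z ^ 4 * D - (n + 1) * (z ^ 2 + T) = z ^ 4 * (C - X) / (n + 1) := by
      rw [hE, hD, hC, hA', hB']
      linear_combination ih₂
    have h₃ : C - X = 0 := by
      have hne : ((n : ℂ) + 1) ^ 4 - z ^ 4 ≠ 0 := by
        have e₁ := natCast_succ_sq_add_ne_zero (norm_neg_one_pow_mul_sq_lt hz 0) n
        have e₂ := natCast_succ_sq_add_ne_zero (norm_neg_one_pow_mul_sq_lt hz 1) n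
        have := mul_ne_zero e₁ e₂
        convert this using 1
        ring
      rw [h₂] at h₁
      apply mul_left_cancel₀ hne
      field_simp at h₁
      linear_combination h₁
    rw [h₃] at h₂
    exact ⟨sub_eq_zero.1 h₃, sub_eq_zero.1 (by simpa using h₂)⟩

/-! ### Evaluation of the infinite product -/

/-- The partial product `∏_{k ≤ n} (1 - z² / k²)`. -/
noncomputable def sineProd (z : ℂ) (n : ℕ) : ℂ := ∏ k ∈ range n, (1 - z ^ 2 / ((k : ℂ) + 1) ^ 2)

theorem tendsto_sineProd {z : ℂ} (hz : z ≠ 0) :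
    Tendsto (sineProd z) atTop (𝓝 (Complex.sin (Real.pi * z) / (Real.pi * z))) := by
  refine (tendsto_euler_sin_prod' hz).congr fun n => prod_congr rfl fun k _ => ?_
  rw [sineTerm]
  ring

/-- The factors with `k = 2j` are sine factors at `z/2` and `iz/2`. The odd factors are the full
product divided by the even one, and they enter inverted, so the even part appears squared. -/
theorem altProd_two_mul {z : ℂ} (hz : ‖z‖ < 1) (m : ℕ) :
    altProd z (2 * m) * (sineProd (z / 2) m ^ 2 * sineProd (Complex.I * z) (2 * m)) =
      sineProd (Complex.I * z / 2) m ^ 2 * sineProd z (2 * m) := by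
  induction m with
  | zero => simp [altProd_zero, sineProd]
  | succ m ih =>
    have h₁ := altProd_succ hz (2 * m)
    have h₂ := altProd_succ hz (2 * m + 1)
    have e : (-1 : ℂ) ^ (2 * m) = 1 := by simp
    rw [pow_succ (-1 : ℂ), e] at h₂
    rw [e] at h₁
    have n₁ : (2 * m + 1 : ℂ) ≠ 0 := by exact_mod_cast (2 * m).succ_ne_zero
    have n₂ : (2 * m + 1 + 1 : ℂ) ≠ 0 := by exact_mod_cast (2 * m + 1).succ_ne_zero
    have n₃ : (m + 1 : ℂ) ≠ 0 := m.cast_add_one_ne_zero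
    have q (u : ℂ) (n : ℕ) :
        sineProd u (n + 1) = sineProd u n * (1 - u ^ 2 / ((n : ℂ) + 1) ^ 2) :=
      prod_range_succ _ _
    rw [show 2 * (m + 1) = 2 * m + 1 + 1 by ring]
    simp only [q, mul_pow, div_pow, Complex.I_sq]
    push_cast at h₁ h₂ ⊢
    have r₁ : altProd z (2 * m + 1) * (1 - -1 * z ^ 2 / (2 * m + 1) ^ 2) =
        altProd z (2 * m) * (1 - z ^ 2 / (2 * m + 1) ^ 2) := by
      field_simp
      linear_combination h₁
    have r₂ : altProd z (2 * m + 1 + 1) * (1 - z ^ 2 / 2 ^ 2 / (m + 1) ^ 2) =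
        altProd z (2 * m + 1) * (1 - -1 * z ^ 2 / 2 ^ 2 / (m + 1) ^ 2) := by
      field_simp
      linear_combination h₂
    have r₃ : z ^ 2 / (2 * m + 1 + 1 : ℂ) ^ 2 = z ^ 2 / 2 ^ 2 / (m + 1) ^ 2 := by
      rw [show (2 * m + 1 + 1 : ℂ) = 2 * (m + 1) by ring]
      field_simp
    have r₄ : -1 * z ^ 2 / (2 * m + 1 + 1 : ℂ) ^ 2 = -1 * z ^ 2 / 2 ^ 2 / (m + 1) ^ 2 := by
      rw [show (2 * m + 1 + 1 : ℂ) = 2 * (m + 1) by ring]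
      field_simp
    rw [r₃, r₄]
    generalize z ^ 2 / 2 ^ 2 / ((m : ℂ) + 1) ^ 2 = a at *
    generalize -1 * z ^ 2 / 2 ^ 2 / ((m : ℂ) + 1) ^ 2 = a' at *
    generalize z ^ 2 / (2 * (m : ℂ) + 1) ^ 2 = b at *
    generalize -1 * z ^ 2 / (2 * (m : ℂ) + 1) ^ 2 = b' at *
    generalize sineProd (z / 2) m = A at *
    generalize sineProd (Complex.I * z / 2) m = A' at *
    generalize sineProd z (2 * m) = B at *
    generalize sineProd (Complex.I * z) (2 * m) = B' at *
    linear_combination A ^ 2 * B' * (1 - a) * (1 - b') * (1 - a') * r₂ +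
      A ^ 2 * B' * (1 - a) * (1 - a') ^ 2 * r₁ + (1 - a) * (1 - b) * (1 - a') ^ 2 * ih

theorem sin_pi_mul_ne_zero_of_norm_lt_one {z : ℂ} (h₀ : z ≠ 0) (hz : ‖z‖ < 1) : Complex.sin (Real.pi * z) ≠ 0 := by
  intro h
  obtain ⟨k, hk⟩ := Complex.sin_eq_zero_iff.1 h
  have hpi : (Real.pi : ℂ) ≠ 0 := by exact_mod_cast Real.pi_ne_zero
  have : z = k := mul_left_cancel₀ hpi (by rw [hk]; ring)
  rw [this, Complex.norm_intCast] at hz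
  have : k = 0 := Int.abs_lt_one_iff.1 (by exact_mod_cast hz)
  simp_all

theorem tendsto_altProd_two_mul {z : ℂ} (hz : ‖z‖ < 1) :
    Tendsto (fun m => altProd z (2 * m)) atTop (𝓝 (tanhCot z)) := by
  rcases eq_or_ne z 0 with rfl | h₀
  · have h (n : ℕ) : altProd 0 n = 1 := by
      refine prod_eq_one fun k _ => ?_
      have : (k : ℂ) + 1 ≠ 0 := k.cast_add_one_ne_zero
      simp [this]
    simp [h, tanhCot]
  have hI : Complex.I * z ≠ 0 := mul_ne_zero Complex.I_ne_zero h₀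
  have hIz : ‖Complex.I * z‖ < 1 := by simpa using hz
  have hhalf (u : ℂ) (hu : ‖u‖ < 1) : ‖u / 2‖ < 1 := by
    rw [norm_div, Complex.norm_ofNat]; linarith [norm_nonneg u]
  have h2 : Tendsto (fun m : ℕ => 2 * m) atTop atTop :=
    tendsto_id.const_mul_atTop' two_pos
  have hpi : (Real.pi : ℂ) ≠ 0 := by exact_mod_cast Real.pi_ne_zero
  have s₁ := sin_pi_mul_ne_zero_of_norm_lt_one (div_ne_zero h₀ two_ne_zero) (hhalf z hz)
  have s₂ := sin_pi_mul_ne_zero_of_norm_lt_one hI hIz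
  have t₁ := ((tendsto_sineProd (div_ne_zero h₀ two_ne_zero)).pow 2).mul
    ((tendsto_sineProd hI).comp h2)
  have t₂ := ((tendsto_sineProd (div_ne_zero hI two_ne_zero)).pow 2).mul
    ((tendsto_sineProd h₀).comp h2)
  have hne : (Complex.sin (Real.pi * (z / 2)) / (Real.pi * (z / 2))) ^ 2 *
      (Complex.sin (Real.pi * (Complex.I * z)) / (Real.pi * (Complex.I * z))) ≠ 0 := by
    exact mul_ne_zero (pow_ne_zero _ (div_ne_zero s₁ (mul_ne_zero hpi
      (div_ne_zero h₀ two_ne_zero)))) (div_ne_zero s₂ (mul_ne_zero hpi hI))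
  have t := t₂.div t₁ hne
  have hev := t₁.eventually_ne hne
  have hlim : tanhCot z = (Complex.sin (Real.pi * (Complex.I * z / 2)) /
        (Real.pi * (Complex.I * z / 2))) ^ 2 *
        (Complex.sin (Real.pi * z) / (Real.pi * z)) /
      ((Complex.sin (Real.pi * (z / 2)) / (Real.pi * (z / 2))) ^ 2 *
        (Complex.sin (Real.pi * (Complex.I * z)) / (Real.pi * (Complex.I * z)))) := by
    rw [tanhCot, Function.update_of_ne h₀, Complex.tanh_eq_sinh_div_cosh,
      Complex.cot_eq_cos_div_sin]
    have e₁ : Real.pi * (z / 2) = Real.pi * z / 2 := by ring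
    have e₂ : Real.pi * (Complex.I * z / 2) = Real.pi * z / 2 * Complex.I := by ring
    have e₃ : Real.pi * (Complex.I * z) = 2 * (Real.pi * z / 2 * Complex.I) := by ring
    have e₄ : Real.pi * z = 2 * (Real.pi * z / 2) := by ring
    have hy : Real.pi * z / 2 ≠ 0 := div_ne_zero (mul_ne_zero hpi h₀) two_ne_zero
    rw [e₁] at s₁
    rw [e₃] at s₂
    rw [e₁, e₂, e₃, show Complex.sin (Real.pi * z) / (Real.pi * z) =
      Complex.sin (2 * (Real.pi * z / 2)) / (2 * (Real.pi * z / 2)) by rw [← e₄]]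
    generalize Real.pi * z / 2 = y at *
    -- Since `sin(2iy) = 2i sinh y cosh y`, its nonvanishing yields that of both `sinh y` and `cosh
    -- y`.
    simp only [Complex.sin_two_mul, Complex.sin_mul_I, Complex.cos_mul_I] at s₂ ⊢
    have c₁ : Complex.cosh y ≠ 0 := right_ne_zero_of_mul s₂
    have c₂ : Complex.sinh y ≠ 0 := left_ne_zero_of_mul (right_ne_zero_of_mul
      (left_ne_zero_of_mul s₂))
    have := Complex.I_ne_zero
    field_simp
  rw [hlim]
  refine t.congr' (hev.mono fun m hm => ?_)
  rw [Pi.div_apply, div_eq_iff hm]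
  exact (altProd_two_mul hz m).symm

/-- An odd partial product differs from the preceding even one by a factor tending to `1`. -/
theorem tendsto_altProd {z : ℂ} (hz : ‖z‖ < 1) :
    Tendsto (altProd z) atTop (𝓝 (tanhCot z)) := by
  have h₀ := tendsto_altProd_two_mul hz
  have h₁ : Tendsto (fun m => altProd z (2 * m + 1)) atTop (𝓝 (tanhCot z)) := by
    have hi : Tendsto (fun m : ℕ => z ^ 2 * (1 / (((2 * m : ℕ) : ℂ) + 1)) ^ 2) atTop (𝓝 0) := by
      simpa using (((tendsto_one_div_add_atTop_nhds_zero_nat (𝕜 := ℂ)).comp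
        (tendsto_id.const_mul_atTop' two_pos)).pow 2).const_mul (z ^ 2)
    have := h₀.mul ((hi.const_sub 1).div (hi.const_add 1) (by simp))
    simp only [sub_zero, add_zero, div_one, mul_one] at this
    refine this.congr fun m => ?_
    have h := altProd_succ hz (2 * m)
    have hne := natCast_succ_sq_add_ne_zero (norm_neg_one_pow_mul_sq_lt hz (2 * m)) (2 * m)
    have hk : ((2 * m : ℕ) : ℂ) + 1 ≠ 0 := Nat.cast_add_one_ne_zero _
    simp only [even_two, Even.mul_right, Even.neg_pow, one_pow, one_mul] at h hne
    simp only [Pi.div_apply]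
    rw [← mul_right_inj' hne, mul_comm _ (altProd z (2 * m + 1)), h]
    generalize ((2 * m : ℕ) : ℂ) + 1 = K at *
    have : 1 + z ^ 2 * (1 / K) ^ 2 ≠ 0 := by
      intro h'
      apply hne
      field_simp at h'
      simpa using h'
    field_simp
  intro s hs
  obtain ⟨a, ha⟩ := eventually_atTop.1 (h₀ hs)
  obtain ⟨b, hb⟩ := eventually_atTop.1 (h₁ hs)
  refine eventually_atTop.2 ⟨2 * (a + b), fun n hn => ?_⟩
  obtain ⟨m, rfl | rfl⟩ := Nat.even_or_odd' n
  · exact ha m (by lia)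
  · exact hb m (by lia)

/-! ### Passage to the limit -/

/-- Convergence makes `P_k` bounded, so the recurrence gives increments of order `1/k²`. This is the
dominating series for the weighted sums. -/
theorem summable_norm_altProd_sub {z : ℂ} (hz : ‖z‖ < 1) :
    Summable fun k => ‖altProd z (k + 1) - altProd z k‖ := by
  obtain ⟨M, hM⟩ := (tendsto_altProd hz).norm.bddAbove_range
  have hM (k : ℕ) : ‖altProd z k‖ ≤ M := hM ⟨k, rfl⟩
  have hsum : Summable fun k : ℕ => 2 * M * (1 / ((k : ℝ) + 1) ^ 2) :=
    (summable_of_sum_range_le (c := 2) (fun _ => by positivity) fun n =>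
      (sum_range_one_div_sq_le n).trans (by
        rw [div_le_iff₀ (by positivity)]; linarith)).mul_left _
  refine hsum.of_nonneg_of_le (fun _ => norm_nonneg _) fun k => ?_
  have hk : (k : ℂ) + 1 ≠ 0 := k.cast_add_one_ne_zero
  have h : altProd z (k + 1) - altProd z k =
      -((-1) ^ k * z ^ 2) * (altProd z (k + 1) + altProd z k) / ((k : ℂ) + 1) ^ 2 := by
    rw [eq_div_iff (pow_ne_zero _ hk)]
    linear_combination altProd_succ hz k
  have hk' : ‖((k : ℂ) + 1) ^ 2‖ = ((k : ℝ) + 1) ^ 2 := by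
    rw [norm_pow]
    congr 1
    exact_mod_cast Complex.norm_natCast (k + 1)
  rw [h, norm_div, hk', norm_mul, norm_neg, mul_one_div]
  refine div_le_div_of_nonneg_right ?_ (by positivity)
  calc _ ≤ 1 * (‖altProd z (k + 1)‖ + ‖altProd z k‖) := by
        gcongr
        · exact (norm_neg_one_pow_mul_sq_lt hz k).le
        · exact norm_add_le _ _
    _ ≤ _ := by linarith [hM k, hM (k + 1)]

/-- Dominated convergence: the weights are at most `1` in absolute value and tend to `1`, and the
unweighted series telescopes. -/
theorem tendsto_weightedSum {z : ℂ} (hz : ‖z‖ < 1) :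
    Tendsto (weightedSum z) atTop (𝓝 (tanhCot z)) := by
  have hs := summable_norm_altProd_sub hz
  have hsum : ∑' k, (altProd z (k + 1) - altProd z k) = tanhCot z - 1 := by
    refine tendsto_nhds_unique hs.of_norm.hasSum.tendsto_sum_nat ?_
    simp only [sum_range_sub, altProd_zero]
    exact (tendsto_altProd hz).sub_const 1
  have h (n : ℕ) : weightedSum z n =
      1 + ∑' k, (centralWeight n (k + 1) : ℂ) * (altProd z (k + 1) - altProd z k) := by
    rw [weightedSum, tsum_eq_sum (s := range n)]
    intro k hk
    rw [centralWeight_eq_zero (Nat.lt_succ_of_le (by simpa using hk))]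
    simp
  have key : Tendsto (fun n => ∑' k, (centralWeight n (k + 1) : ℂ) *
      (altProd z (k + 1) - altProd z k)) atTop (𝓝 (∑' k, (altProd z (k + 1) - altProd z k))) := by
    refine tendsto_tsum_of_dominated_convergence hs (fun k => ?_)
      (Eventually.of_forall fun n k => ?_)
    · simpa using ((Complex.continuous_ofReal.tendsto _).comp
        (tendsto_centralWeight (k + 1))).mul_const (altProd z (k + 1) - altProd z k)
    · rw [norm_mul, Complex.norm_real, Real.norm_eq_abs]
      exact mul_le_of_le_one_left (norm_nonneg _) (abs_centralWeight_le_one _ _)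
  rw [hsum] at key
  simpa [← h] using key.const_add 1

theorem tendsto_tanh_mul_cot :
    Tendsto (fun z : ℂ => Complex.tanh (Real.pi * z / 2) * Complex.cot (Real.pi * z / 2))
      (𝓝[≠] 0) (𝓝 1) := by
  have hpi : (Real.pi : ℂ) ≠ 0 := by exact_mod_cast Real.pi_ne_zero
  have hsin : Tendsto (fun y : ℂ => Complex.sin y / y) (𝓝[≠] 0) (𝓝 1) := by
    have := hasDerivAt_iff_tendsto_slope.1 (Complex.hasDerivAt_sin 0)
    simpa [slope_fun_def, div_eq_inv_mul] using this
  have hsinh : Tendsto (fun y : ℂ => Complex.sinh y / y) (𝓝[≠] 0) (𝓝 1) := by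
    have := hasDerivAt_iff_tendsto_slope.1 (Complex.hasDerivAt_sinh 0)
    simpa [slope_fun_def, div_eq_inv_mul] using this
  have hcos : Tendsto (fun y : ℂ => Complex.cos y / Complex.cosh y) (𝓝[≠] 0) (𝓝 1) := by
    have : ContinuousAt (fun y : ℂ => Complex.cos y / Complex.cosh y) 0 :=
      Complex.continuous_cos.continuousAt.div Complex.continuous_cosh.continuousAt (by simp)
    simpa using this.tendsto.mono_left nhdsWithin_le_nhds
  have key : Tendsto (fun y : ℂ => Complex.tanh y * Complex.cot y) (𝓝[≠] 0) (𝓝 1) := by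
    have := (hsinh.div hsin one_ne_zero).mul hcos
    rw [div_one, mul_one] at this
    refine this.congr' (eventually_mem_nhdsWithin.mono fun y hy => ?_)
    have hy : y ≠ 0 := hy
    simp only [Pi.div_apply]
    rw [div_div_div_cancel_right₀ hy, Complex.tanh_eq_sinh_div_cosh,
      Complex.cot_eq_cos_div_sin]
    ring
  have hlin : Tendsto (fun z : ℂ => Real.pi * z / 2) (𝓝[≠] 0) (𝓝[≠] 0) := by
    refine tendsto_nhdsWithin_iff.2 ⟨?_, eventually_mem_nhdsWithin.mono fun z hz => ?_⟩
    · have : Continuous fun z : ℂ => Real.pi * z / 2 := by fun_prop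
      simpa using (this.tendsto 0).mono_left nhdsWithin_le_nhds
    · exact div_ne_zero (mul_ne_zero hpi hz) two_ne_zero
  exact key.comp hlin

theorem theorem2p3 :
    (∀ d : ℕ, Summable (zetaStarTerm (index31 d)) ∧
      Summable (zetaStarTerm (index31 d ++ [2]))) ∧
    Filter.Tendsto
      (fun z : ℂ => Complex.tanh (Real.pi * z / 2) * Complex.cot (Real.pi * z / 2))
      (nhdsWithin 0 {0}ᶜ) (nhds 1) ∧
    ∀ z : ℂ, ‖z‖ < 1 →
      Summable (fun d : ℕ => (zetaStar (index31 d) : ℂ) * z ^ (4 * d)) ∧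
      Summable (fun d : ℕ => (zetaStar (index31 d ++ [2]) : ℂ) * z ^ (4 * d + 2)) ∧
      (∑' d : ℕ, (zetaStar (index31 d) : ℂ) * z ^ (4 * d)) -
          ∑' d : ℕ, (zetaStar (index31 d ++ [2]) : ℂ) * z ^ (4 * d + 2) =
        tanhCot z := by
  have h₀ : starSum [] 0 ≤ 2 := by norm_num [starSum_nil]
  have h₀' : starSum [2] 0 ≤ 2 := by norm_num [starSum_cons]
  refine ⟨fun d => ⟨?_, (zetaStar_index31_append h₀' starSum_two_le d).1⟩,
    tendsto_tanh_mul_cot, fun z hz => ?_⟩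
  · have := (zetaStar_index31_append h₀ starSum_nil_le d).1
    rwa [List.append_nil] at this
  have sA := summable_zetaStar_mul_pow h₀ starSum_nil_le hz
  have sB := summable_zetaStar_mul_pow h₀' starSum_two_le hz
  have lA := tendsto_genFun h₀ starSum_nil_le hz
  have lB := tendsto_genFun h₀' starSum_two_le hz
  simp only [List.append_nil] at sA lA
  simp only [pow_add, ← mul_assoc]
  refine ⟨sA, sB.mul_right _, ?_⟩
  rw [tsum_mul_right]
  refine tendsto_nhds_unique ?_ (tendsto_weightedSum hz)
  rw [mul_comm _ (z ^ 2)]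
  exact (lA.sub (lB.const_mul (z ^ 2))).congr fun n => (genFun_sub_eq_weightedSum hz n).1
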